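/- Let $P_2(\mathbb{R}^n)$ be the set of Borel probability measures on $\mathbb{R}^n$ with finite second moment, and for $\mu,\nu\in P_2(\mathbb{R}^n)$ let $$W_2^2(\mu,\nu)=\inf_\gamma\int_{\mathbb{R}^n\times\mathbb{R}^n}|x-y|^2\,d\gamma(x,y),$$ where $\gamma$ runs over all Borel probability measures on $\mathbb{R}^n\times\mathbb{R}^n$ with marginals $\mu$ and $\nu$. Let $M\subseteq\mathbb{R}^n$ be bounded, and let $[0,1]\ni t\mapsto\mu_t$ be a weakly continuous curve of Borel probability measures on $\mathbb{R}^n$, each concentrated on $M$. 1. For every $\nu\in P_2(\mathbb{R}^n)$ the function $t\mapsto W_2^2(\mu_t,\nu)$ is finite and integrable on $[0,1]$, and the functional $$J(\nu)=\int_0^1W_2^2(\mu_t,\nu)\,dt$$ is convex on $P_2(\mathbb{R}^n)$ with respect to the usual linear structure: $J(a\nu_0+b\nu_1)\le aJ(\nu_0)+bJ(\nu_1)$ for $a,b\ge0$, $a+b=1$. 2. If the set of $t\in[0,1]$ for which $\mu_t$ is absolutely continuous with respect to Lebesgue measure has positive Lebesgue measure, then $J$ is strictly convex on $P_2(\mathbb{R}^n)$,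 and the curve has exactly one barycenter, that is, there is exactly one minimizer of $J$ over $P_2(\mathbb{R}^n)$. -/

import Mathlib

open MeasureTheory
open scoped NNReal ENNReal

noncomputable section

/-- Borel probability measures on `ℝⁿ` with finite second moment. -/
def P2 (n : ℕ) : Set (Measure (EuclideanSpace ℝ (Fin n))) :=
  {μ | IsProbabilityMeasure μ ∧ ∫⁻ x, ‖x‖ₑ ^ 2 ∂μ < ∞}

/-- Measures `γ` on `ℝⁿ × ℝⁿ` with marginals `μ` and `ν`. If `μ` is a probability measure, then
so is every such `γ`. -/
def couplings {n : ℕ} (μ ν : Measure (EuclideanSpace ℝ (Fin n))) :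
    Set (Measure (EuclideanSpace ℝ (Fin n) × EuclideanSpace ℝ (Fin n))) :=
  {γ | γ.fst = μ ∧ γ.snd = ν}

/-- The squared quadratic Wasserstein distance, as an extended nonnegative number: the infimum of
`∫ |x - y|² dγ(x, y)` over all couplings `γ`. -/
def eW2Sq {n : ℕ} (μ ν : Measure (EuclideanSpace ℝ (Fin n))) : ℝ≥0∞ :=
  ⨅ γ ∈ couplings μ ν, ∫⁻ p, ‖p.1 - p.2‖ₑ ^ 2 ∂γ

/-- The squared quadratic Wasserstein distance as a real number. -/
def W2Sq {n : ℕ} (μ ν : Measure (EuclideanSpace ℝ (Fin n))) : ℝ :=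
  (eW2Sq μ ν).toReal

/-- The functional `ν ↦ ∫₀¹ W₂²(μ_t, ν) dt` of a curve `t ↦ μ_t`, `t ∈ [0, 1]`. -/
def curveCost {n : ℕ} (μ : unitInterval → ProbabilityMeasure (EuclideanSpace ℝ (Fin n)))
    (ν : Measure (EuclideanSpace ℝ (Fin n))) : ℝ :=
  ∫ t : unitInterval, W2Sq (μ t : Measure (EuclideanSpace ℝ (Fin n))) ν

/-- A barycenter of the curve `μ`: a minimizer of `curveCost μ` over `P2 n`. -/
def IsBarycenter {n : ℕ} (μ : unitInterval → ProbabilityMeasure (EuclideanSpace ℝ (Fin n)))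
    (m : Measure (EuclideanSpace ℝ (Fin n))) : Prop :=
  m ∈ P2 n ∧ ∀ ν ∈ P2 n, curveCost μ m ≤ curveCost μ ν

/-- The set of times at which `μ_t` is absolutely continuous has positive Lebesgue measure. -/
def AssumptionA {n : ℕ}
    (μ : unitInterval → ProbabilityMeasure (EuclideanSpace ℝ (Fin n))) : Prop :=
  0 < volume {t : unitInterval | (μ t : Measure (EuclideanSpace ℝ (Fin n))) ≪ volume}

end

/-! Mixing couplings of μ with ν₀ and ν₁ gives a coupling of μ with the mixture, so W₂² is convex in
its second argument. Integrating over t makes J convex. Integrability comes from joint weak lower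
semicontinuity of W₂² and from second moment bounds that are uniform in t because M is bounded.

Strictness: if equality holds at μ ≪ volume, the mixture of two optimal couplings is itself optimal.
Its support is monotone (`inner_nonneg_of_mem_support`), hence single-valued off a Lebesgue null set
(`volume_setOf_multivalued_eq_zero`). Both couplings live on that one graph over μ, so ν₀ = ν₁
(`snd_eq_of_fst_eq_of_single_valued`). A set of such t of positive measure makes J strictly convex.

Existence of a minimizer is the direct method: J is lower semicontinuous by Fatou, and its sublevel
sets have bounded second moments, hence lie in a weakly compact set. -/

section Wasserstein

open Filter Topology Set BoundedContinuousFunction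

/-! ### Weak lower semicontinuity of integrals -/

/-- Integration of a nonnegative continuous function is a lower semicontinuous function of the
probability measure. -/
theorem lowerSemicontinuous_lintegral_probabilityMeasure {X : Type*} [TopologicalSpace X]
    [MeasurableSpace X] [OpensMeasurableSpace X] {f : X → ℝ≥0} (hf : Continuous f) :
    LowerSemicontinuous (fun γ : ProbabilityMeasure X ↦ ∫⁻ x, f x ∂(γ : Measure X)) := by
  -- Truncations at height k have weakly continuous integrals; by monotone convergence the integral
  -- of f is their supremum.
  let g (k : ℕ) : X →ᵇ ℝ≥0 := BoundedContinuousFunction.mkOfBound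
    ⟨fun x ↦ min (f x) k, by fun_prop⟩ k (fun x y ↦ by
      rw [NNReal.dist_eq, abs_sub_le_iff]
      have h1 : ((min (f x) k : ℝ≥0) : ℝ) ≤ k := by exact_mod_cast min_le_right _ _
      have h2 : ((min (f y) k : ℝ≥0) : ℝ) ≤ k := by exact_mod_cast min_le_right _ _
      have h3 : (0 : ℝ) ≤ (min (f x) k : ℝ≥0) := NNReal.coe_nonneg _
      have h4 : (0 : ℝ) ≤ (min (f y) k : ℝ≥0) := NNReal.coe_nonneg _
      constructor <;> simp only [ContinuousMap.coe_mk] <;> linarith)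
  have hsup (γ : ProbabilityMeasure X) :
      ∫⁻ x, f x ∂(γ : Measure X) = ⨆ k, ∫⁻ x, g k x ∂(γ : Measure X) := by
    rw [← lintegral_iSup]
    · refine lintegral_congr fun x ↦ le_antisymm ?_ (iSup_le fun k ↦ ?_)
      · obtain ⟨k, hk⟩ := exists_nat_ge (f x)
        refine le_iSup_of_le k ?_
        change (f x : ℝ≥0∞) ≤ ((min (f x) k : ℝ≥0) : ℝ≥0∞)
        rw [min_eq_left hk]
      · exact ENNReal.coe_le_coe.2 (min_le_left _ _)
    · exact fun k ↦ (g k).continuous.measurable.coe_nnreal_ennreal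
    · intro k l hkl x
      exact ENNReal.coe_le_coe.2 (min_le_min le_rfl (by exact_mod_cast hkl))
  simp_rw [hsup]
  refine lowerSemicontinuous_iSup fun k ↦ Continuous.lowerSemicontinuous ?_
  have := ENNReal.continuous_coe.comp (ProbabilityMeasure.continuous_testAgainstNN_eval (g k))
  refine this.congr fun γ ↦ ?_
  exact FiniteMeasure.testAgainstNN_coe_eq

variable {n : ℕ}

local notation "𝔼" n => EuclideanSpace ℝ (Fin n)

theorem lowerSemicontinuous_lintegral_sq_dist :
    LowerSemicontinuous (fun γ : ProbabilityMeasure ((𝔼 n) × (𝔼 n)) ↦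
      ∫⁻ p, ‖p.1 - p.2‖ₑ ^ 2 ∂(γ : Measure ((𝔼 n) × (𝔼 n)))) := by
  have h := lowerSemicontinuous_lintegral_probabilityMeasure
    (X := (𝔼 n) × (𝔼 n)) (f := fun p ↦ ‖p.1 - p.2‖₊ ^ 2) (by fun_prop)
  simpa [enorm_eq_nnnorm] using h

theorem lowerSemicontinuous_lintegral_sq_norm :
    LowerSemicontinuous (fun γ : ProbabilityMeasure (𝔼 n) ↦
      ∫⁻ x, ‖x‖ₑ ^ 2 ∂(γ : Measure (𝔼 n))) := by
  have h := lowerSemicontinuous_lintegral_probabilityMeasure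
    (X := 𝔼 n) (f := fun p ↦ ‖p‖₊ ^ 2) (by fun_prop)
  simpa [enorm_eq_nnnorm] using h

/-! ### Compactness of couplings and optimal couplings -/

/-- The pair of marginals of a probability measure on a product. -/
noncomputable def marginals (γ : ProbabilityMeasure ((𝔼 n) × (𝔼 n))) :
    ProbabilityMeasure (𝔼 n) × ProbabilityMeasure (𝔼 n) :=
  (γ.map measurable_fst.aemeasurable, γ.map measurable_snd.aemeasurable)

theorem continuous_marginals : Continuous (marginals (n := n)) :=
  (ProbabilityMeasure.continuous_map continuous_fst).prodMk
    (ProbabilityMeasure.continuous_map continuous_snd)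

theorem marginals_fst_coe (γ : ProbabilityMeasure ((𝔼 n) × (𝔼 n))) :
    ((marginals γ).1 : Measure (𝔼 n)) = (γ : Measure ((𝔼 n) × (𝔼 n))).fst := rfl

theorem marginals_snd_coe (γ : ProbabilityMeasure ((𝔼 n) × (𝔼 n))) :
    ((marginals γ).2 : Measure (𝔼 n)) = (γ : Measure ((𝔼 n) × (𝔼 n))).snd := rfl

theorem mem_couplings_iff_marginals {μ ν : ProbabilityMeasure (𝔼 n)}
    {γ : ProbabilityMeasure ((𝔼 n) × (𝔼 n))} :
    (γ : Measure ((𝔼 n) × (𝔼 n))) ∈ couplings (μ : Measure (𝔼 n)) ν ↔ marginals γ = (μ, ν) := by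
  refine ⟨fun h ↦ Prod.ext (Subtype.ext h.1) (Subtype.ext h.2), fun h ↦ ?_⟩
  exact ⟨congrArg (fun p ↦ (p.1 : Measure (𝔼 n))) h, congrArg (fun p ↦ (p.2 : Measure (𝔼 n))) h⟩

/-- The couplings of measures from two compact sets form a compact set. -/
theorem isCompact_preimage_marginals {K₁ K₂ : Set (ProbabilityMeasure (𝔼 n))}
    (h₁ : IsCompact K₁) (h₂ : IsCompact K₂) :
    IsCompact (marginals ⁻¹' (K₁ ×ˢ K₂)) := by
  have hcl : IsClosed (marginals ⁻¹' (K₁ ×ˢ K₂)) :=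
    (h₁.isClosed.prod h₂.isClosed).preimage continuous_marginals
  rw [← hcl.closure_eq]
  refine isCompact_closure_of_isTightMeasureSet ?_
  -- Prokhorov in both directions: tightness of the two marginal families passes to the couplings,
  -- with ε/2 lost per factor.
  have t₁ := isTightMeasureSet_of_isCompact_closure (by rwa [h₁.isClosed.closure_eq])
  have t₂ := isTightMeasureSet_of_isCompact_closure (by rwa [h₂.isClosed.closure_eq])
  rw [isTightMeasureSet_iff_exists_isCompact_measure_compl_le] at t₁ t₂ ⊢
  intro ε hε
  obtain ⟨C₁, hC₁, hC₁'⟩ := t₁ (ε / 2) (ENNReal.half_pos hε.ne')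
  obtain ⟨C₂, hC₂, hC₂'⟩ := t₂ (ε / 2) (ENNReal.half_pos hε.ne')
  refine ⟨C₁ ×ˢ C₂, hC₁.prod hC₂, ?_⟩
  rintro _ ⟨γ, hγ, rfl⟩
  have e : (C₁ ×ˢ C₂)ᶜ ⊆ (Prod.fst ⁻¹' C₁ᶜ ∪ Prod.snd ⁻¹' C₂ᶜ : Set ((𝔼 n) × (𝔼 n))) := by
    intro p hp
    by_contra h
    simp_all
  have b₁ := hC₁' _ ⟨_, hγ.1, rfl⟩
  have b₂ := hC₂' _ ⟨_, hγ.2, rfl⟩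
  rw [marginals_fst_coe, Measure.fst_apply hC₁.measurableSet.compl] at b₁
  rw [marginals_snd_coe, Measure.snd_apply hC₂.measurableSet.compl] at b₂
  calc _ ≤ _ := measure_mono e
    _ ≤ _ := measure_union_le _ _
    _ ≤ ε / 2 + ε / 2 := add_le_add b₁ b₂
    _ = ε := ENNReal.add_halves ε

theorem isProbabilityMeasure_of_mem_couplings {μ ν : Measure (𝔼 n)} [IsProbabilityMeasure μ]
    {γ : Measure ((𝔼 n) × (𝔼 n))} (h : γ ∈ couplings μ ν) : IsProbabilityMeasure γ :=
  ⟨by rw [← Measure.fst_univ, h.1, measure_univ]⟩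

theorem eW2Sq_le_of_mem_couplings {μ ν : Measure (𝔼 n)} {γ : Measure ((𝔼 n) × (𝔼 n))}
    (h : γ ∈ couplings μ ν) : eW2Sq μ ν ≤ ∫⁻ p, ‖p.1 - p.2‖ₑ ^ 2 ∂γ :=
  iInf₂_le γ h

/-- Existence of an optimal coupling. -/
theorem exists_optimal_marginals (μ ν : ProbabilityMeasure (𝔼 n)) :
    ∃ γ : ProbabilityMeasure ((𝔼 n) × (𝔼 n)), marginals γ = (μ, ν) ∧
      ∫⁻ p, ‖p.1 - p.2‖ₑ ^ 2 ∂(γ : Measure ((𝔼 n) × (𝔼 n))) = eW2Sq (μ : Measure (𝔼 n)) ν := by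
  have hc := isCompact_preimage_marginals (isCompact_singleton (x := μ))
    (isCompact_singleton (x := ν))
  rw [singleton_prod_singleton] at hc
  have hprod : marginals (μ.prod ν) = (μ, ν) :=
    mem_couplings_iff_marginals.1 ⟨by simp, by simp⟩
  obtain ⟨γ, hγ, hmin⟩ := LowerSemicontinuousOn.exists_isMinOn
    (s := marginals ⁻¹' {(μ, ν)}) ⟨_, hprod⟩ hc
    ((lowerSemicontinuous_lintegral_sq_dist (n := n)).lowerSemicontinuousOn _)
  refine ⟨γ, hγ, le_antisymm (le_iInf₂ fun γ' hγ' ↦ ?_)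
    (eW2Sq_le_of_mem_couplings (mem_couplings_iff_marginals.2 hγ))⟩
  obtain ⟨γ', rfl⟩ : ∃ π : ProbabilityMeasure ((𝔼 n) × (𝔼 n)), (π : Measure _) = γ' :=
    ⟨⟨γ', isProbabilityMeasure_of_mem_couplings hγ'⟩, rfl⟩
  exact hmin (mem_couplings_iff_marginals.1 hγ')

theorem exists_optimal_coupling (μ ν : Measure (𝔼 n)) [hμ : IsProbabilityMeasure μ]
    [hν : IsProbabilityMeasure ν] :
    ∃ γ ∈ couplings μ ν, ∫⁻ p, ‖p.1 - p.2‖ₑ ^ 2 ∂γ = eW2Sq μ ν := by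
  obtain ⟨γ, hγ, h⟩ := exists_optimal_marginals (⟨μ, hμ⟩ : ProbabilityMeasure (𝔼 n)) ⟨ν, hν⟩
  exact ⟨γ, mem_couplings_iff_marginals.2 hγ, h⟩

/-- Joint lower semicontinuity of the squared Wasserstein distance. -/
theorem lowerSemicontinuous_eW2Sq :
    LowerSemicontinuous (fun p : ProbabilityMeasure (𝔼 n) × ProbabilityMeasure (𝔼 n) ↦
      eW2Sq (p.1 : Measure (𝔼 n)) p.2) := by
  rw [lowerSemicontinuous_iff_isClosed_preimage]
  intro c
  refine IsSeqClosed.isClosed fun p q hp hpq ↦ ?_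
  rw [nhds_prod_eq, tendsto_prod_iff'] at hpq
  -- A convergent sequence with its limit is compact, so the optimal couplings of all `p k` lie in
  -- one compact set of cost at most c; its image under `marginals` is closed and so contains q.
  have hc := (isCompact_preimage_marginals hpq.1.isCompact_insert_range
    hpq.2.isCompact_insert_range).inter_right
      ((lowerSemicontinuous_lintegral_sq_dist (n := n)).isClosed_preimage c)
  have hcl := (hc.image continuous_marginals).isClosed
  have hpk (k : ℕ) : p k ∈ marginals '' (marginals ⁻¹'
      (insert q.1 (range fun k ↦ (p k).1) ×ˢ insert q.2 (range fun k ↦ (p k).2)) ∩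
        (fun γ : ProbabilityMeasure ((𝔼 n) × (𝔼 n)) ↦
          ∫⁻ p, ‖p.1 - p.2‖ₑ ^ 2 ∂(γ : Measure ((𝔼 n) × (𝔼 n)))) ⁻¹' Iic c) := by
    obtain ⟨γ, hγ, hγc⟩ := exists_optimal_marginals (p k).1 (p k).2
    refine ⟨γ, ⟨?_, hγc.le.trans (hp k)⟩, hγ⟩
    rw [mem_preimage, hγ]
    exact ⟨.inr ⟨k, rfl⟩, .inr ⟨k, rfl⟩⟩
  obtain ⟨γ, hγ, hq⟩ := hcl.mem_of_tendsto (hpq.1.prodMk_nhds hpq.2) (Eventually.of_forall hpk)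
  exact (eW2Sq_le_of_mem_couplings (mem_couplings_iff_marginals.2 hq)).trans hγ.2

/-! ### Second moment bounds and convexity of W₂² -/

theorem enorm_sub_sq_le {F : Type*} [SeminormedAddCommGroup F] (x y : F) :
    ‖x - y‖ₑ ^ 2 ≤ 2 * ‖x‖ₑ ^ 2 + 2 * ‖y‖ₑ ^ 2 := by
  simp only [enorm_eq_nnnorm]
  norm_cast
  rw [← NNReal.coe_le_coe]
  push_cast
  have := norm_sub_le x y
  nlinarith [norm_nonneg (x - y), sq_nonneg (‖x‖ - ‖y‖)]

theorem lintegral_comp_fst_of_mem_couplings {μ ν : Measure (𝔼 n)} {γ : Measure ((𝔼 n) × (𝔼 n))}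
    (h : γ ∈ couplings μ ν) {f : (𝔼 n) → ℝ≥0∞} (hf : Measurable f) :
    ∫⁻ p, f p.1 ∂γ = ∫⁻ x, f x ∂μ := by
  rw [← h.1, Measure.fst, lintegral_map hf measurable_fst]

theorem lintegral_comp_snd_of_mem_couplings {μ ν : Measure (𝔼 n)} {γ : Measure ((𝔼 n) × (𝔼 n))}
    (h : γ ∈ couplings μ ν) {f : (𝔼 n) → ℝ≥0∞} (hf : Measurable f) :
    ∫⁻ p, f p.2 ∂γ = ∫⁻ x, f x ∂ν := by
  rw [← h.2, Measure.snd, lintegral_map hf measurable_snd]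

theorem eW2Sq_le_second_moments (μ ν : Measure (𝔼 n)) [IsProbabilityMeasure μ]
    [IsProbabilityMeasure ν] :
    eW2Sq μ ν ≤ 2 * ∫⁻ x, ‖x‖ₑ ^ 2 ∂μ + 2 * ∫⁻ x, ‖x‖ₑ ^ 2 ∂ν := by
  obtain ⟨γ, hγ, hc⟩ := exists_optimal_coupling μ ν
  rw [← hc, ← lintegral_comp_fst_of_mem_couplings hγ (by fun_prop),
    ← lintegral_comp_snd_of_mem_couplings hγ (by fun_prop), ← lintegral_const_mul _ (by fun_prop),
    ← lintegral_const_mul _ (by fun_prop), ← lintegral_add_left (by fun_prop)]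
  exact lintegral_mono fun p ↦ enorm_sub_sq_le _ _

/-- Coercivity, from y = x - (x - y) under an optimal coupling. -/
theorem second_moment_le_eW2Sq (μ ν : Measure (𝔼 n)) [IsProbabilityMeasure μ]
    [IsProbabilityMeasure ν] :
    ∫⁻ x, ‖x‖ₑ ^ 2 ∂ν ≤ 2 * ∫⁻ x, ‖x‖ₑ ^ 2 ∂μ + 2 * eW2Sq μ ν := by
  obtain ⟨γ, hγ, hc⟩ := exists_optimal_coupling μ ν
  rw [← hc, ← lintegral_comp_fst_of_mem_couplings hγ (by fun_prop),
    ← lintegral_comp_snd_of_mem_couplings hγ (by fun_prop), ← lintegral_const_mul _ (by fun_prop),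
    ← lintegral_const_mul _ (by fun_prop), ← lintegral_add_left (by fun_prop)]
  refine lintegral_mono fun p ↦ ?_
  simpa using enorm_sub_sq_le p.1 (p.1 - p.2)

theorem convexComb_mem_couplings {μ ν₀ ν₁ : Measure (𝔼 n)} {γ₀ γ₁ : Measure ((𝔼 n) × (𝔼 n))}
    (h₀ : γ₀ ∈ couplings μ ν₀) (h₁ : γ₁ ∈ couplings μ ν₁) {a b : ℝ≥0} (hab : a + b = 1) :
    a • γ₀ + b • γ₁ ∈ couplings μ (a • ν₀ + b • ν₁) := by
  constructor
  · rw [Measure.fst_add]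
    simp only [Measure.fst, Measure.map_smul]
    rw [← Measure.fst, ← Measure.fst, h₀.1, h₁.1, ← add_smul, hab, one_smul]
  · rw [Measure.snd_add]
    simp only [Measure.snd, Measure.map_smul]
    rw [← Measure.snd, ← Measure.snd, h₀.2, h₁.2]

theorem lintegral_convexComb {X : Type*} [MeasurableSpace X] (μ₀ μ₁ : Measure X) (a b : ℝ≥0)
    (f : X → ℝ≥0∞) :
    ∫⁻ x, f x ∂(a • μ₀ + b • μ₁) = a * ∫⁻ x, f x ∂μ₀ + b * ∫⁻ x, f x ∂μ₁ := by
  rw [lintegral_add_measure, lintegral_smul_measure, lintegral_smul_measure]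
  rfl

/-- Convexity of the squared Wasserstein distance in the second argument. -/
theorem eW2Sq_convexComb_le (μ ν₀ ν₁ : Measure (𝔼 n)) [IsProbabilityMeasure μ]
    [IsProbabilityMeasure ν₀] [IsProbabilityMeasure ν₁] {a b : ℝ≥0} (hab : a + b = 1) :
    eW2Sq μ (a • ν₀ + b • ν₁) ≤ a * eW2Sq μ ν₀ + b * eW2Sq μ ν₁ := by
  obtain ⟨γ₀, h₀, hc₀⟩ := exists_optimal_coupling μ ν₀
  obtain ⟨γ₁, h₁, hc₁⟩ := exists_optimal_coupling μ ν₁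
  rw [← hc₀, ← hc₁, ← lintegral_convexComb]
  exact eW2Sq_le_of_mem_couplings (convexComb_mem_couplings h₀ h₁ hab)

/-! ### Monotone supports and strict convexity -/

/-- The left side minus the right side is 2⟨x - x', y - y'⟩: re-pairing is cheaper exactly where
monotonicity fails. -/
theorem enorm_sq_add_enorm_sq_lt_of_inner_neg {F : Type*} [NormedAddCommGroup F]
    [InnerProductSpace ℝ F] {x y x' y' : F} (h : inner ℝ (x - x') (y - y') < 0) :
    ‖x - y'‖ₑ ^ 2 + ‖x' - y‖ₑ ^ 2 < ‖x - y‖ₑ ^ 2 + ‖x' - y'‖ₑ ^ 2 := by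
  simp only [enorm_eq_nnnorm]
  norm_cast
  rw [← NNReal.coe_lt_coe]
  push_cast
  simp only [norm_sub_sq_real]
  simp only [inner_sub_left, inner_sub_right] at h
  linarith

theorem lintegral_prod_fst_snd {X Y X' Y' : Type*} [MeasurableSpace X] [MeasurableSpace Y]
    [MeasurableSpace X'] [MeasurableSpace Y'] (α : Measure (X × Y)) (β : Measure (X' × Y'))
    [IsFiniteMeasure α] [IsFiniteMeasure β] {f : X × Y' → ℝ≥0∞} (hf : Measurable f) :
    ∫⁻ z, f z ∂(α.fst.prod β.snd) = ∫⁻ z, f (z.1.1, z.2.2) ∂(α.prod β) := by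
  rw [Measure.fst, Measure.snd, Measure.map_prod_map _ _ measurable_fst measurable_snd,
    lintegral_map hf (by fun_prop)]
  rfl

/-- The support of an optimal coupling of finite cost is a monotone relation. -/
theorem inner_nonneg_of_mem_support {μ ν : Measure (𝔼 n)} [IsProbabilityMeasure μ]
    {γ : Measure ((𝔼 n) × (𝔼 n))} (hγ : γ ∈ couplings μ ν)
    (hopt : ∫⁻ p, ‖p.1 - p.2‖ₑ ^ 2 ∂γ = eW2Sq μ ν) (hfin : eW2Sq μ ν ≠ ∞)
    {p q : (𝔼 n) × (𝔼 n)} (hp : p ∈ γ.support) (hq : q ∈ γ.support) :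
    0 ≤ inner ℝ (p.1 - q.1) (p.2 - q.2) := by
  by_contra! hneg
  have := isProbabilityMeasure_of_mem_couplings hγ
  have hopen : IsOpen {z : ((𝔼 n) × (𝔼 n)) × ((𝔼 n) × (𝔼 n)) |
      inner ℝ (z.1.1 - z.2.1) (z.1.2 - z.2.2) < 0} :=
    isOpen_lt (by fun_prop) continuous_const
  obtain ⟨U, V, hU, hpU, hV, hqV, hUV⟩ := mem_nhds_prod_iff'.1 (hopen.mem_nhds hneg)
  have hdisj : Disjoint U V := by
    rw [Set.disjoint_left]
    intro z hzU hzV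
    simpa using hUV (mk_mem_prod hzU hzV)
  set α := γ.restrict U with hα
  set β := γ.restrict V with hβ
  set ρ := γ.restrict (U ∪ V)ᶜ with hρ
  have hdec : γ = ρ + α + β := by
    rw [add_assoc, hα, hβ, hρ, ← Measure.restrict_union hdisj hV.measurableSet, add_comm,
      Measure.restrict_add_restrict_compl (hU.union hV).measurableSet]
  have hαu : α univ = γ U := by simp [hα]
  have hβu : β univ = γ V := by simp [hβ]
  have hα1 : α univ ≤ 1 := hαu.le.trans prob_le_one
  have hβ1 : β univ ≤ 1 := hβu.le.trans prob_le_one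
  have hα0 : α univ ≠ 0 := hαu ▸ ((Measure.mem_support_iff_forall p).1 hp U (hU.mem_nhds hpU)).ne'
  have hβ0 : β univ ≠ 0 := hβu ▸ ((Measure.mem_support_iff_forall q).1 hq V (hV.mem_nhds hqV)).ne'
  set c : (𝔼 n) × (𝔼 n) → ℝ≥0∞ := fun p ↦ ‖p.1 - p.2‖ₑ ^ 2 with hc
  have hcm : Measurable c := by fun_prop
  set a := α univ
  set b := β univ
  have hsplit (x : Measure (𝔼 n)) {r : ℝ≥0∞} (hr : r ≤ 1) : (1 - r) • x + r • x = x := by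
    rw [← add_smul, tsub_add_cancel_of_le hr, one_smul]
  have hsplit' (x : ℝ≥0∞) {r : ℝ≥0∞} (hr : r ≤ 1) : (1 - r) * x + r * x = x := by
    rw [← add_mul, tsub_add_cancel_of_le hr, one_mul]
  -- Remove mass ab from each of α and β and reconnect it crosswise. The products have marginals
  -- scaled by a or b, which restores the marginals of γ; a, b ≤ 1 makes the subtractions exact.
  let γ' := ρ + (1 - b) • α + (1 - a) • β + α.fst.prod β.snd + β.fst.prod α.snd
  have hγ' : γ' ∈ couplings μ ν := by
    constructor
    · rw [← hγ.1, hdec]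
      have hprod (x y : Measure (𝔼 n)) [SFinite x] [SFinite y] :
          (x.prod y).fst = y univ • x := Measure.map_fst_prod
      have hsmul (r : ℝ≥0∞) (x : Measure ((𝔼 n) × (𝔼 n))) : (r • x).fst = r • x.fst :=
        Measure.map_smul r x _
      simp only [γ', Measure.fst_add, hprod, hsmul, Measure.snd_univ]
      change ρ.fst + (1 - b) • α.fst + (1 - a) • β.fst + b • α.fst + a • β.fst = _
      conv_rhs => rw [← hsplit α.fst hβ1, ← hsplit β.fst hα1]
      abel
    · rw [← hγ.2, hdec]
      have hprod (x y : Measure (𝔼 n)) [SFinite x] [SFinite y] :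
          (x.prod y).snd = x univ • y := Measure.map_snd_prod
      have hsmul (r : ℝ≥0∞) (x : Measure ((𝔼 n) × (𝔼 n))) : (r • x).snd = r • x.snd :=
        Measure.map_smul r x _
      simp only [γ', Measure.snd_add, hprod, hsmul, Measure.fst_univ]
      change ρ.snd + (1 - b) • α.snd + (1 - a) • β.snd + a • β.snd + b • α.snd = _
      conv_rhs => rw [← hsplit α.snd hβ1, ← hsplit β.snd hα1]
      abel
  have hI : ∫⁻ p, c p ∂γ ≠ ∞ := hopt ▸ hfin
  have hαI : ∫⁻ p, c p ∂α ≠ ∞ := ne_top_of_le_ne_top hI (lintegral_mono' Measure.restrict_le_self le_rfl)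
  have hβI : ∫⁻ p, c p ∂β ≠ ∞ := ne_top_of_le_ne_top hI (lintegral_mono' Measure.restrict_le_self le_rfl)
  have hX : ∫⁻ z, c z ∂(α.fst.prod β.snd) + ∫⁻ z, c z ∂(β.fst.prod α.snd) =
      ∫⁻ z, c (z.1.1, z.2.2) + c (z.2.1, z.1.2) ∂(α.prod β) := by
    rw [lintegral_prod_fst_snd _ _ hcm, lintegral_prod_fst_snd _ _ hcm,
      lintegral_add_left (by fun_prop), ← lintegral_prod_swap (μ := β) (ν := α)]
    rfl
  have hY : ∫⁻ z, c z.1 + c z.2 ∂(α.prod β) = b * ∫⁻ p, c p ∂α + a * ∫⁻ p, c p ∂β := by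
    rw [lintegral_add_left (by fun_prop), ← lintegral_map hcm measurable_fst,
      ← lintegral_map hcm measurable_snd, Measure.map_fst_prod, Measure.map_snd_prod,
      lintegral_smul_measure, lintegral_smul_measure]
    rfl
  have hlt : ∀ᵐ z ∂(α.prod β), c (z.1.1, z.2.2) + c (z.2.1, z.1.2) < c z.1 + c z.2 := by
    rw [hα, hβ, Measure.prod_restrict]
    exact ae_restrict_of_forall_mem (hU.measurableSet.prod hV.measurableSet) fun z hz ↦
      enorm_sq_add_enorm_sq_lt_of_inner_neg (hUV hz)
  have hYfin : ∫⁻ z, c z.1 + c z.2 ∂(α.prod β) ≠ ∞ := by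
    rw [hY]
    exact ENNReal.add_ne_top.2 ⟨ENNReal.mul_ne_top (measure_ne_top _ _) hαI,
      ENNReal.mul_ne_top (measure_ne_top _ _) hβI⟩
  have hXY : ∫⁻ z, c (z.1.1, z.2.2) + c (z.2.1, z.1.2) ∂(α.prod β) <
      ∫⁻ z, c z.1 + c z.2 ∂(α.prod β) := by
    refine lintegral_strict_mono ?_ (by fun_prop) ?_ hlt
    · rw [← Measure.measure_univ_ne_zero, ← univ_prod_univ, Measure.prod_prod]
      exact mul_ne_zero hα0 hβ0
    · exact ne_top_of_le_ne_top hYfin (lintegral_mono_ae (hlt.mono fun _ h ↦ h.le))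
  have hle := hopt.le.trans (eW2Sq_le_of_mem_couplings hγ')
  change ∫⁻ p, c p ∂γ ≤ ∫⁻ p, c p ∂γ' at hle
  -- The cost change is stated additively because ℝ≥0∞ has no true subtraction; the finite cost of γ
  -- is cancelled at the end.
  have hγ'I : ∫⁻ p, c p ∂γ' + ∫⁻ z, c z.1 + c z.2 ∂(α.prod β) =
      ∫⁻ p, c p ∂γ + ∫⁻ z, c (z.1.1, z.2.2) + c (z.2.1, z.1.2) ∂(α.prod β) := by
    rw [← hX, hY]
    conv_rhs => rw [hdec]
    simp only [γ', lintegral_add_measure, lintegral_smul_measure, smul_eq_mul]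
    conv_rhs => rw [← hsplit' (∫⁻ p, c p ∂α) hβ1, ← hsplit' (∫⁻ p, c p ∂β) hα1]
    ring
  refine absurd hXY (not_lt.2 ?_)
  rw [← ENNReal.add_le_add_iff_left hI, ← hγ'I]
  gcongr

/-- A monotone relation is single-valued outside a Lebesgue null set. -/
theorem volume_setOf_multivalued_eq_zero {F : Type*} [NormedAddCommGroup F]
    [InnerProductSpace ℝ F] [FiniteDimensional ℝ F] [MeasurableSpace F] [BorelSpace F]
    {Γ : Set (F × F)} (hΓ : ∀ p ∈ Γ, ∀ q ∈ Γ, 0 ≤ inner ℝ (p.1 - q.1) (p.2 - q.2)) :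
    volume {x | ∃ y y', (x, y) ∈ Γ ∧ (x, y') ∈ Γ ∧ y ≠ y'} = 0 := by
  -- Two values separated in direction e by the gap (r, s) and bounded by N; countably many such
  -- sets cover all multivalued points.
  let S (e : F) (r s : ℝ) (N : ℝ) : Set F := {x | ∃ y y', (x, y) ∈ Γ ∧ (x, y') ∈ Γ ∧
    inner ℝ e y ≤ r ∧ s ≤ inner ℝ e y' ∧ ‖y‖ ≤ N ∧ ‖y'‖ ≤ N}
  -- Monotonicity applied to the upper value at x₁ and the lower value at x₂. The bound is a closed
  -- condition, so it survives on the closure, which is measurable.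
  have hcone {e : F} {r s N t : ℝ} (ht : 0 ≤ t) :
      ∀ x₁ ∈ closure (S e r s N), ∀ x₂ ∈ closure (S e r s N),
        t * (s - r) ≤ 2 * N * ‖x₁ - x₂ + t • e‖ := by
    have hcl : IsClosed {z : F × F | t * (s - r) ≤ 2 * N * ‖z.1 - z.2 + t • e‖} :=
      isClosed_le continuous_const (by fun_prop)
    suffices h : closure (S e r s N ×ˢ S e r s N) ⊆
        {z : F × F | t * (s - r) ≤ 2 * N * ‖z.1 - z.2 + t • e‖} by
      rw [closure_prod_eq] at h
      intro x₁ h₁ x₂ h₂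
      simpa using h (mk_mem_prod h₁ h₂)
    refine closure_minimal ?_ hcl
    rintro ⟨x₁, x₂⟩ ⟨⟨-, y₁, -, hy₁, -, hs, -, hN₁⟩, ⟨y₂, -, hy₂, -, hr, -, hN₂, -⟩⟩
    have h₁ := hΓ _ hy₁ _ hy₂
    have h₂ : inner ℝ (x₁ - x₂) (y₁ - y₂) =
        inner ℝ (x₁ - x₂ + t • e) (y₁ - y₂) - t * (inner ℝ e y₁ - inner ℝ e y₂) := by
      rw [inner_add_left, real_inner_smul_left, inner_sub_right e]
      ring
    have h₃ := real_inner_le_norm (x₁ - x₂ + t • e) (y₁ - y₂)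
    have h₄ : ‖y₁ - y₂‖ ≤ 2 * N := (norm_sub_le _ _).trans (by linarith)
    have h₅ := mul_le_mul_of_nonneg_left h₄ (norm_nonneg (x₁ - x₂ + t • e))
    have h₆ : t * (s - r) ≤ t * (inner ℝ e y₁ - inner ℝ e y₂) := by gcongr
    simp only [mem_ofPred_eq] at h₁ ⊢
    linarith
  have hnull {e : F} {r s N : ℝ} (hrs : r < s) : volume (S e r s N) = 0 := by
    refine measure_mono_null subset_closure ?_
    -- Fubini along e: if x₁ = x₂ - t • e with t > 0, the cone bound reads t(s - r) ≤ 0, so each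
    -- line parallel to e meets the closure at most once.
    have h := ae_mem_of_ae_add_linearMap_mem (LinearMap.toSpanSingleton ℝ F e) volume
      (volume : Measure F) (s := (closure (S e r s N))ᶜ)
      isClosed_closure.measurableSet.compl fun y ↦ ?_
    · simpa [ae_iff] using h
    · have hnlt (t₁ t₂ : ℝ) (h₁ : y + t₁ • e ∈ closure (S e r s N))
          (h₂ : y + t₂ • e ∈ closure (S e r s N)) : ¬ t₁ < t₂ := by
        intro hlt
        have := hcone (sub_pos.2 hlt).le _ h₁ _ h₂
        rw [show y + t₁ • e - (y + t₂ • e) + (t₂ - t₁) • e = 0 by module, norm_zero,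
          mul_zero] at this
        exact this.not_gt (mul_pos (sub_pos.2 hlt) (sub_pos.2 hrs))
      rw [ae_iff]
      refine Set.Subsingleton.measure_zero (fun t₁ h₁ t₂ h₂ ↦ ?_) _
      simp only [LinearMap.toSpanSingleton_apply, mem_compl_iff, not_not, mem_ofPred_eq] at h₁ h₂
      exact le_antisymm (not_lt.1 (hnlt t₂ t₁ h₂ h₁)) (not_lt.1 (hnlt t₁ t₂ h₁ h₂))
  have hcover : {x | ∃ y y', (x, y) ∈ Γ ∧ (x, y') ∈ Γ ∧ y ≠ y'} ⊆
      ⋃ (i : ℕ) (r : ℚ) (s : ℚ) (_ : r < s) (N : ℕ), S (TopologicalSpace.denseSeq F i) r s N := by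
    rintro x ⟨y, y', hy, hy', hne⟩
    obtain ⟨i, hi⟩ := (TopologicalSpace.denseRange_denseSeq F).exists_mem_open
      (s := {e : F | 0 < inner ℝ e (y' - y)}) (isOpen_lt continuous_const (by fun_prop))
      ⟨y' - y, real_inner_self_pos.2 (sub_ne_zero.2 hne.symm)⟩
    rw [mem_ofPred_eq, inner_sub_right, sub_pos] at hi
    obtain ⟨r, hr, hr'⟩ := exists_rat_btwn hi
    obtain ⟨s, hs, hs'⟩ := exists_rat_btwn hr'
    obtain ⟨N, hN⟩ := exists_nat_ge (max ‖y‖ ‖y'‖)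
    simp only [mem_iUnion]
    exact ⟨i, r, s, by exact_mod_cast hs, N, y, y', hy, hy', hr.le, hs'.le,
      (le_max_left _ _).trans hN, (le_max_right _ _).trans hN⟩
  refine measure_mono_null hcover ?_
  simp only [measure_iUnion_null_iff]
  exact fun i r s hrs N ↦ hnull (by exact_mod_cast hrs)

/-- Two measures concentrated on a relation that is single-valued almost everywhere have the same
second marginal if they have the same first marginal. -/
theorem snd_eq_of_fst_eq_of_single_valued {X Y : Type*} [MeasurableSpace X] [MeasurableSpace Y]
    [StandardBorelSpace X] [StandardBorelSpace Y] {γ₀ γ₁ : Measure (X × Y)} {Γ : Set (X × Y)}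
    (hΓ : MeasurableSet Γ) (h₀ : γ₀ Γᶜ = 0) (h₁ : γ₁ Γᶜ = 0) (hfst : γ₀.fst = γ₁.fst)
    (hs : γ₀.fst {x | ∃ y y', (x, y) ∈ Γ ∧ (x, y') ∈ Γ ∧ y ≠ y'} = 0) : γ₀.snd = γ₁.snd := by
  obtain ⟨N, hN, hNm, hN0⟩ := exists_measurable_superset_of_null hs
  set G := Γ ∩ Prod.fst ⁻¹' Nᶜ
  have hG : MeasurableSet G := hΓ.inter (measurable_fst hNm.compl)
  have hinj : InjOn Prod.fst G := by
    rintro ⟨x, y⟩ ⟨hp, hpN⟩ ⟨x', y'⟩ ⟨hq, -⟩ (rfl : x = x')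
    by_contra hne
    exact hpN (hN ⟨y, y', hp, hq, fun h ↦ hne (by rw [h])⟩)
  have hGc (γ : Measure (X × Y)) (h : γ Γᶜ = 0) (h' : γ.fst N = 0) : ∀ᵐ p ∂γ, p ∈ G := by
    rw [Measure.fst_apply hNm] at h'
    filter_upwards [mem_ae_iff.2 h, measure_eq_zero_iff_ae_notMem.1 h'] with p hp hp'
    exact ⟨hp, hp'⟩
  ext B hB
  -- Lusin–Souslin: an injective measurable image of a Borel set is Borel.
  have hA : MeasurableSet (Prod.fst '' (G ∩ Prod.snd ⁻¹' B)) :=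
    (hG.inter (measurable_snd hB)).image_of_measurable_injOn measurable_fst
      (hinj.mono inter_subset_left)
  have key (γ : Measure (X × Y)) (h : ∀ᵐ p ∂γ, p ∈ G) :
      γ.snd B = γ.fst (Prod.fst '' (G ∩ Prod.snd ⁻¹' B)) := by
    rw [Measure.snd_apply hB, Measure.fst_apply hA]
    refine measure_congr ?_
    filter_upwards [h] with p hp
    refine propext ⟨fun hpB ↦ ⟨p, ⟨hp, hpB⟩, rfl⟩, ?_⟩
    rintro ⟨q, ⟨hq, hqB⟩, hqp⟩
    rw [← hinj hq hp hqp]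
    exact hqB
  rw [key γ₀ (hGc γ₀ h₀ hN0), key γ₁ (hGc γ₁ h₁ (hfst ▸ hN0)), hfst]

/-- Strict convexity of the squared Wasserstein distance from an absolutely continuous measure. -/
theorem eW2Sq_convexComb_lt {μ ν₀ ν₁ : Measure (𝔼 n)} [IsProbabilityMeasure μ]
    [IsProbabilityMeasure ν₀] [IsProbabilityMeasure ν₁] (hμ : μ ≪ volume) (hne : ν₀ ≠ ν₁)
    (hf₀ : eW2Sq μ ν₀ ≠ ∞) (hf₁ : eW2Sq μ ν₁ ≠ ∞)
    {a b : ℝ≥0} (ha : 0 < a) (hb : 0 < b) (hab : a + b = 1) :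
    eW2Sq μ (a • ν₀ + b • ν₁) < a * eW2Sq μ ν₀ + b * eW2Sq μ ν₁ := by
  refine (eW2Sq_convexComb_le μ ν₀ ν₁ hab).lt_of_ne fun heq ↦ hne ?_
  obtain ⟨γ₀, h₀, hc₀⟩ := exists_optimal_coupling μ ν₀
  obtain ⟨γ₁, h₁, hc₁⟩ := exists_optimal_coupling μ ν₁
  have hγ := convexComb_mem_couplings h₀ h₁ hab
  have hopt : ∫⁻ p, ‖p.1 - p.2‖ₑ ^ 2 ∂(a • γ₀ + b • γ₁) = eW2Sq μ (a • ν₀ + b • ν₁) := by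
    rw [heq, lintegral_convexComb, hc₀, hc₁]
  have hfin : eW2Sq μ (a • ν₀ + b • ν₁) ≠ ∞ := by
    rw [heq]
    exact ENNReal.add_ne_top.2 ⟨ENNReal.mul_ne_top ENNReal.coe_ne_top hf₀,
      ENNReal.mul_ne_top ENNReal.coe_ne_top hf₁⟩
  have hsupp : (a • γ₀ + b • γ₁) (a • γ₀ + b • γ₁).supportᶜ = 0 :=
    Measure.measure_compl_support
  -- Both weights are positive, so a null set of the mixture is null for each coupling.
  have hsupp' : γ₀ (a • γ₀ + b • γ₁).supportᶜ = 0 ∧ γ₁ (a • γ₀ + b • γ₁).supportᶜ = 0 := by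
    simpa only [Measure.coe_add, Measure.coe_nnreal_smul_apply, Pi.add_apply, add_eq_zero,
      mul_eq_zero, ENNReal.coe_eq_zero, ha.ne', hb.ne', false_or] using hsupp
  rw [← h₀.2, ← h₁.2]
  refine snd_eq_of_fst_eq_of_single_valued Measure.isClosed_support.measurableSet hsupp'.1 hsupp'.2
    (h₀.1.trans h₁.1.symm) ?_
  rw [h₀.1]
  exact hμ (volume_setOf_multivalued_eq_zero fun p hp q hq ↦
    inner_nonneg_of_mem_support hγ hopt hfin hp hq)

/-! ### Measures with bounded second moment -/

theorem lintegral_sq_norm_le_of_concentrated {μ : Measure (𝔼 n)} [IsProbabilityMeasure μ]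
    {M : Set (𝔼 n)} {R : ℝ≥0} (hM : ∀ x ∈ M, ‖x‖ ≤ R) (hμ : μ Mᶜ = 0) :
    ∫⁻ x, ‖x‖ₑ ^ 2 ∂μ ≤ ((R ^ 2 : ℝ≥0) : ℝ≥0∞) := by
  have h : ∀ᵐ x ∂μ, ‖x‖ₑ ^ 2 ≤ ((R ^ 2 : ℝ≥0) : ℝ≥0∞) := by
    filter_upwards [mem_ae_iff.2 hμ] with x hx
    have : ‖x‖₊ ≤ R := hM x hx
    rw [enorm_eq_nnnorm]
    norm_cast
    gcongr
  simpa using lintegral_mono_ae h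

theorem convex_P2 : Convex ℝ≥0 (P2 n) := by
  rintro ν₀ ⟨hp₀, hm₀⟩ ν₁ ⟨hp₁, hm₁⟩ a b - - hab
  refine ⟨⟨?_⟩, ?_⟩
  · rw [Measure.add_apply, Measure.smul_apply, Measure.smul_apply, measure_univ, measure_univ,
      ← add_smul, hab, one_smul]
  · rw [lintegral_convexComb]
    exact ENNReal.add_lt_top.2 ⟨ENNReal.mul_lt_top ENNReal.coe_lt_top hm₀,
      ENNReal.mul_lt_top ENNReal.coe_lt_top hm₁⟩

/-- Probability measures with uniformly bounded second moments form a compact set. -/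
theorem isCompact_setOf_second_moment_le (C : ℝ≥0) :
    IsCompact {ν : ProbabilityMeasure (𝔼 n) | ∫⁻ x, ‖x‖ₑ ^ 2 ∂(ν : Measure (𝔼 n)) ≤ C} := by
  have hcl : IsClosed {ν : ProbabilityMeasure (𝔼 n) |
      ∫⁻ x, ‖x‖ₑ ^ 2 ∂(ν : Measure (𝔼 n)) ≤ C} :=
    (lowerSemicontinuous_lintegral_sq_norm (n := n)).isClosed_preimage C
  rw [← hcl.closure_eq]
  refine isCompact_closure_of_isTightMeasureSet ?_
  rw [isTightMeasureSet_iff_exists_isCompact_measure_compl_le]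
  intro ε hε
  -- Markov at level r, with C < rε. Since r ≥ 1, ‖x‖ > r implies ‖x‖² ≥ r, so r also serves as the
  -- radius.
  obtain ⟨r, hr⟩ := ENNReal.exists_nat_mul_gt hε.ne' (ENNReal.coe_ne_top (r := C))
  refine ⟨Metric.closedBall 0 r, isCompact_closedBall _ _, ?_⟩
  rintro _ ⟨ν, hν, rfl⟩
  have hr0 : (r : ℝ≥0∞) ≠ 0 := by
    rintro h
    simp [h] at hr
  have hsub : (Metric.closedBall (0 : 𝔼 n) r)ᶜ ⊆ {x | (r : ℝ≥0∞) ≤ ‖x‖ₑ ^ 2} := by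
    intro x hx
    have hx' : (r : ℝ) < ‖x‖ := by simpa using hx
    have hr1 : (1 : ℝ) ≤ r := by
      exact_mod_cast Nat.one_le_iff_ne_zero.2 fun h ↦ hr0 (by simp [h])
    have : (r : ℝ≥0) ≤ ‖x‖₊ ^ 2 := by
      rw [← NNReal.coe_le_coe]
      push_cast
      nlinarith
    rw [mem_ofPred_eq, enorm_eq_nnnorm]
    exact_mod_cast this
  have hmarkov := mul_meas_ge_le_lintegral (μ := (ν : Measure (𝔼 n))) (f := fun x ↦ ‖x‖ₑ ^ 2)
    (by fun_prop) (r : ℝ≥0∞)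
  refine (measure_mono hsub).trans ?_
  rw [← ENNReal.mul_le_mul_iff_right hr0 (ENNReal.natCast_ne_top r)]
  exact hmarkov.trans (le_trans hν hr.le)

/-! ### The functional J: convexity and barycenters -/

section Curve

variable {μ : unitInterval → ProbabilityMeasure (𝔼 n)} {C : ℝ≥0}

theorem measurable_eW2Sq_curve (hμ : Continuous μ) (ν : ProbabilityMeasure (𝔼 n)) :
    Measurable fun t ↦ eW2Sq (μ t : Measure (𝔼 n)) (ν : Measure (𝔼 n)) :=
  (lowerSemicontinuous_eW2Sq.comp (hμ.prodMk continuous_const)).measurable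

/-- The curve cost is lower semicontinuous. -/
theorem lowerSemicontinuous_lintegral_eW2Sq (hμ : Continuous μ) :
    LowerSemicontinuous fun ν : ProbabilityMeasure (𝔼 n) ↦
      ∫⁻ t, eW2Sq (μ t : Measure (𝔼 n)) (ν : Measure (𝔼 n)) := by
  rw [lowerSemicontinuous_iff_isClosed_preimage]
  intro c
  refine IsSeqClosed.isClosed fun ν ν' hν hlim ↦ ?_
  calc ∫⁻ t, eW2Sq (μ t : Measure (𝔼 n)) (ν' : Measure (𝔼 n))
      ≤ ∫⁻ t, liminf (fun k ↦ eW2Sq (μ t : Measure (𝔼 n)) (ν k : Measure (𝔼 n))) atTop := by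
        refine lintegral_mono fun t ↦ ?_
        have h := (lowerSemicontinuous_eW2Sq.comp
          (Continuous.prodMk_right (μ t))).le_liminf ν'
        exact h.trans (liminf_le_liminf_of_le hlim)
    _ ≤ liminf (fun k ↦ ∫⁻ t, eW2Sq (μ t : Measure (𝔼 n)) (ν k : Measure (𝔼 n))) atTop :=
        lintegral_liminf_le fun k ↦ measurable_eW2Sq_curve hμ _
    _ ≤ c := by
        rw [← liminf_const (f := (atTop : Filter ℕ)) c]
        exact liminf_le_liminf (Eventually.of_forall hν)

theorem eW2Sq_curve_le (hC : ∀ t, ∫⁻ x, ‖x‖ₑ ^ 2 ∂(μ t : Measure (𝔼 n)) ≤ C)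
    (ν : ProbabilityMeasure (𝔼 n)) (t : unitInterval) :
    eW2Sq (μ t : Measure (𝔼 n)) (ν : Measure (𝔼 n)) ≤
      2 * C + 2 * ∫⁻ x, ‖x‖ₑ ^ 2 ∂(ν : Measure (𝔼 n)) :=
  (eW2Sq_le_second_moments _ _).trans (by gcongr; exact hC t)

theorem eW2Sq_curve_lt_top (hC : ∀ t, ∫⁻ x, ‖x‖ₑ ^ 2 ∂(μ t : Measure (𝔼 n)) ≤ C)
    {ν : ProbabilityMeasure (𝔼 n)} (hν : (ν : Measure (𝔼 n)) ∈ P2 n) (t : unitInterval) :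
    eW2Sq (μ t : Measure (𝔼 n)) (ν : Measure (𝔼 n)) < ∞ :=
  (eW2Sq_curve_le hC ν t).trans_lt (ENNReal.add_lt_top.2
    ⟨ENNReal.mul_lt_top ENNReal.ofNat_lt_top ENNReal.coe_lt_top,
      ENNReal.mul_lt_top ENNReal.ofNat_lt_top hν.2⟩)

theorem lintegral_eW2Sq_curve_lt_top
    (hC : ∀ t, ∫⁻ x, ‖x‖ₑ ^ 2 ∂(μ t : Measure (𝔼 n)) ≤ C)
    {ν : ProbabilityMeasure (𝔼 n)} (hν : (ν : Measure (𝔼 n)) ∈ P2 n) :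
    ∫⁻ t, eW2Sq (μ t : Measure (𝔼 n)) (ν : Measure (𝔼 n)) < ∞ := by
  refine (lintegral_mono (eW2Sq_curve_le hC ν)).trans_lt ?_
  rw [lintegral_const, measure_univ, mul_one]
  exact ENNReal.add_lt_top.2 ⟨ENNReal.mul_lt_top ENNReal.ofNat_lt_top ENNReal.coe_lt_top,
      ENNReal.mul_lt_top ENNReal.ofNat_lt_top hν.2⟩

theorem second_moment_le_lintegral_eW2Sq (hμ : Continuous μ)
    (hC : ∀ t, ∫⁻ x, ‖x‖ₑ ^ 2 ∂(μ t : Measure (𝔼 n)) ≤ C) (ν : ProbabilityMeasure (𝔼 n)) :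
    ∫⁻ x, ‖x‖ₑ ^ 2 ∂(ν : Measure (𝔼 n)) ≤
      2 * C + 2 * ∫⁻ t, eW2Sq (μ t : Measure (𝔼 n)) (ν : Measure (𝔼 n)) := by
  have h (t : unitInterval) : ∫⁻ x, ‖x‖ₑ ^ 2 ∂(ν : Measure (𝔼 n)) ≤
      2 * C + 2 * eW2Sq (μ t : Measure (𝔼 n)) (ν : Measure (𝔼 n)) :=
    (second_moment_le_eW2Sq _ _).trans (by gcongr; exact hC t)
  have h' := lintegral_mono (μ := volume) h
  rwa [lintegral_const, measure_univ, mul_one, lintegral_add_left measurable_const,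
    lintegral_const, measure_univ, mul_one,
    lintegral_const_mul _ (measurable_eW2Sq_curve hμ ν)] at h'

theorem curveCost_eq_toReal (hμ : Continuous μ)
    (hC : ∀ t, ∫⁻ x, ‖x‖ₑ ^ 2 ∂(μ t : Measure (𝔼 n)) ≤ C)
    {ν : ProbabilityMeasure (𝔼 n)} (hν : (ν : Measure (𝔼 n)) ∈ P2 n) :
    curveCost μ ν = (∫⁻ t, eW2Sq (μ t : Measure (𝔼 n)) (ν : Measure (𝔼 n))).toReal :=
  integral_toReal (measurable_eW2Sq_curve hμ ν).aemeasurable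
    (Eventually.of_forall (eW2Sq_curve_lt_top hC hν))

theorem curveCost_le_curveCost_iff (hμ : Continuous μ)
    (hC : ∀ t, ∫⁻ x, ‖x‖ₑ ^ 2 ∂(μ t : Measure (𝔼 n)) ≤ C)
    {ν ν' : ProbabilityMeasure (𝔼 n)} (hν : (ν : Measure (𝔼 n)) ∈ P2 n)
    (hν' : (ν' : Measure (𝔼 n)) ∈ P2 n) :
    curveCost μ ν ≤ curveCost μ ν' ↔
      ∫⁻ t, eW2Sq (μ t : Measure (𝔼 n)) (ν : Measure (𝔼 n)) ≤
        ∫⁻ t, eW2Sq (μ t : Measure (𝔼 n)) (ν' : Measure (𝔼 n)) := by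
  rw [curveCost_eq_toReal hμ hC hν, curveCost_eq_toReal hμ hC hν',
    ENNReal.toReal_le_toReal (lintegral_eW2Sq_curve_lt_top hC hν).ne
      (lintegral_eW2Sq_curve_lt_top hC hν').ne]

theorem integrable_W2Sq_curve (hμ : Continuous μ)
    (hC : ∀ t, ∫⁻ x, ‖x‖ₑ ^ 2 ∂(μ t : Measure (𝔼 n)) ≤ C)
    {ν : ProbabilityMeasure (𝔼 n)} (hν : (ν : Measure (𝔼 n)) ∈ P2 n) :
    Integrable (fun t : unitInterval ↦ W2Sq (μ t : Measure (𝔼 n)) (ν : Measure (𝔼 n))) volume :=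
  integrable_toReal_of_lintegral_ne_top (measurable_eW2Sq_curve hμ ν).aemeasurable
    (lintegral_eW2Sq_curve_lt_top hC hν).ne

theorem W2Sq_convexComb_le (hC : ∀ t, ∫⁻ x, ‖x‖ₑ ^ 2 ∂(μ t : Measure (𝔼 n)) ≤ C)
    {ν₀ ν₁ : Measure (𝔼 n)} (hν₀ : ν₀ ∈ P2 n) (hν₁ : ν₁ ∈ P2 n)
    {a b : ℝ≥0} (hab : a + b = 1) (t : unitInterval) :
    W2Sq (μ t : Measure (𝔼 n)) (a • ν₀ + b • ν₁) ≤
      a * W2Sq (μ t : Measure (𝔼 n)) ν₀ + b * W2Sq (μ t : Measure (𝔼 n)) ν₁ := by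
  have := hν₀.1
  have := hν₁.1
  have h₀ := eW2Sq_curve_lt_top hC (ν := ⟨ν₀, hν₀.1⟩) hν₀ t
  have h₁ := eW2Sq_curve_lt_top hC (ν := ⟨ν₁, hν₁.1⟩) hν₁ t
  have h₀' := ENNReal.mul_ne_top (ENNReal.coe_ne_top (r := a)) h₀.ne
  have h₁' := ENNReal.mul_ne_top (ENNReal.coe_ne_top (r := b)) h₁.ne
  have h := ENNReal.toReal_mono (ENNReal.add_ne_top.2 ⟨h₀', h₁'⟩)
    (eW2Sq_convexComb_le (μ t : Measure (𝔼 n)) ν₀ ν₁ hab)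
  rwa [ENNReal.toReal_add h₀' h₁', ENNReal.toReal_mul, ENNReal.toReal_mul] at h

theorem W2Sq_convexComb_lt (hC : ∀ t, ∫⁻ x, ‖x‖ₑ ^ 2 ∂(μ t : Measure (𝔼 n)) ≤ C)
    {ν₀ ν₁ : Measure (𝔼 n)} (hν₀ : ν₀ ∈ P2 n) (hν₁ : ν₁ ∈ P2 n) (hne : ν₀ ≠ ν₁)
    {a b : ℝ≥0} (ha : 0 < a) (hb : 0 < b) (hab : a + b = 1) {t : unitInterval}
    (ht : (μ t : Measure (𝔼 n)) ≪ volume) :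
    W2Sq (μ t : Measure (𝔼 n)) (a • ν₀ + b • ν₁) <
      a * W2Sq (μ t : Measure (𝔼 n)) ν₀ + b * W2Sq (μ t : Measure (𝔼 n)) ν₁ := by
  have := hν₀.1
  have := hν₁.1
  have h₀ := eW2Sq_curve_lt_top hC (ν := ⟨ν₀, hν₀.1⟩) hν₀ t
  have h₁ := eW2Sq_curve_lt_top hC (ν := ⟨ν₁, hν₁.1⟩) hν₁ t
  have h₀' := ENNReal.mul_ne_top (ENNReal.coe_ne_top (r := a)) h₀.ne
  have h₁' := ENNReal.mul_ne_top (ENNReal.coe_ne_top (r := b)) h₁.ne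
  have h := ENNReal.toReal_strict_mono (ENNReal.add_ne_top.2 ⟨h₀', h₁'⟩)
    (eW2Sq_convexComb_lt ht hne h₀.ne h₁.ne ha hb hab)
  rwa [ENNReal.toReal_add h₀' h₁', ENNReal.toReal_mul, ENNReal.toReal_mul] at h

theorem integral_W2Sq_convexComb (hμ : Continuous μ)
    (hC : ∀ t, ∫⁻ x, ‖x‖ₑ ^ 2 ∂(μ t : Measure (𝔼 n)) ≤ C)
    {ν₀ ν₁ : Measure (𝔼 n)} (hν₀ : ν₀ ∈ P2 n) (hν₁ : ν₁ ∈ P2 n) (a b : ℝ≥0) :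
    Integrable (fun t : unitInterval ↦ a * W2Sq (μ t : Measure (𝔼 n)) ν₀ +
        b * W2Sq (μ t : Measure (𝔼 n)) ν₁) volume ∧
      ∫ t : unitInterval, a * W2Sq (μ t : Measure (𝔼 n)) ν₀ +
        b * W2Sq (μ t : Measure (𝔼 n)) ν₁ = a • curveCost μ ν₀ + b • curveCost μ ν₁ := by
  have h₀ := (integrable_W2Sq_curve hμ hC (ν := ⟨ν₀, hν₀.1⟩) hν₀).const_mul (a : ℝ)
  have h₁ := (integrable_W2Sq_curve hμ hC (ν := ⟨ν₁, hν₁.1⟩) hν₁).const_mul (b : ℝ)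
  refine ⟨h₀.add h₁, ?_⟩
  refine (integral_add h₀ h₁).trans ?_
  rw [integral_const_mul, integral_const_mul]
  rfl

theorem convexOn_curveCost (hμ : Continuous μ)
    (hC : ∀ t, ∫⁻ x, ‖x‖ₑ ^ 2 ∂(μ t : Measure (𝔼 n)) ≤ C) :
    ConvexOn ℝ≥0 (P2 n) (curveCost μ) := by
  refine ⟨convex_P2, fun ν₀ hν₀ ν₁ hν₁ a b ha hb hab ↦ ?_⟩
  have hν := convex_P2 hν₀ hν₁ ha hb hab
  have hi := integral_W2Sq_convexComb hμ hC hν₀ hν₁ a b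
  rw [← hi.2]
  exact integral_mono (integrable_W2Sq_curve hμ hC (ν := ⟨_, hν.1⟩) hν) hi.1
    (W2Sq_convexComb_le hC hν₀ hν₁ hab)

theorem strictConvexOn_curveCost (hμ : Continuous μ)
    (hC : ∀ t, ∫⁻ x, ‖x‖ₑ ^ 2 ∂(μ t : Measure (𝔼 n)) ≤ C) (hA : AssumptionA μ) :
    StrictConvexOn ℝ≥0 (P2 n) (curveCost μ) := by
  refine ⟨convex_P2, fun ν₀ hν₀ ν₁ hν₁ hne a b ha hb hab ↦ ?_⟩
  -- Equality of the integrals of ordered functions forces equality for almost every t, which fails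
  -- on the positive-measure set of absolutely continuous times.
  refine ((convexOn_curveCost hμ hC).2 hν₀ hν₁ ha.le hb.le hab).lt_of_ne fun heq ↦ hA.ne' ?_
  have hν := convex_P2 hν₀ hν₁ ha.le hb.le hab
  have hi := integral_W2Sq_convexComb hμ hC hν₀ hν₁ a b
  rw [← hi.2] at heq
  have hae := (integral_eq_iff_of_ae_le (integrable_W2Sq_curve hμ hC (ν := ⟨_, hν.1⟩) hν) hi.1
    (Eventually.of_forall (W2Sq_convexComb_le hC hν₀ hν₁ hab))).1 heq
  exact measure_mono_null (fun t ht ↦ (W2Sq_convexComb_lt hC hν₀ hν₁ hne ha hb hab ht).ne)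
    (ae_iff.1 hae)

theorem exists_isBarycenter (hμ : Continuous μ)
    (hC : ∀ t, ∫⁻ x, ‖x‖ₑ ^ 2 ∂(μ t : Measure (𝔼 n)) ≤ C) : ∃ m, IsBarycenter μ m := by
  let δ : ProbabilityMeasure (𝔼 n) := ⟨Measure.dirac 0, inferInstance⟩
  have hδ0 : ∫⁻ x, ‖x‖ₑ ^ 2 ∂(δ : Measure (𝔼 n)) = 0 := by
    change ∫⁻ x, ‖x‖ₑ ^ 2 ∂(Measure.dirac (0 : 𝔼 n)) = 0
    simp
  have hδ : (δ : Measure (𝔼 n)) ∈ P2 n := ⟨inferInstance, hδ0 ▸ ENNReal.zero_lt_top⟩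
  set J : ProbabilityMeasure (𝔼 n) → ℝ≥0∞ := fun ν ↦
    ∫⁻ t, eW2Sq (μ t : Measure (𝔼 n)) (ν : Measure (𝔼 n))
  have hJδ : J δ ≠ ∞ := (lintegral_eW2Sq_curve_lt_top hC hδ).ne
  -- The moment bound for every ν with J ν ≤ J δ. As δ itself satisfies it, a minimizer under this
  -- bound also beats every ν with J ν ≥ J δ.
  set D : ℝ≥0 := 2 * C + 2 * (J δ).toNNReal with hD
  have hDJ : (D : ℝ≥0∞) = 2 * C + 2 * J δ := by
    rw [hD]
    push_cast
    rw [ENNReal.coe_toNNReal hJδ]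
  obtain ⟨m, hm, hmin⟩ := LowerSemicontinuousOn.exists_isMinOn
    (s := {ν : ProbabilityMeasure (𝔼 n) | ∫⁻ x, ‖x‖ₑ ^ 2 ∂(ν : Measure (𝔼 n)) ≤ D})
    ⟨δ, hδ0.le.trans zero_le⟩ (isCompact_setOf_second_moment_le D)
    ((lowerSemicontinuous_lintegral_eW2Sq hμ).lowerSemicontinuousOn _)
  have hmP : (m : Measure (𝔼 n)) ∈ P2 n := ⟨inferInstance, lt_of_le_of_lt hm ENNReal.coe_lt_top⟩
  refine ⟨m, hmP, fun ν hν ↦ ?_⟩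
  obtain ⟨ν, rfl⟩ : ∃ π : ProbabilityMeasure (𝔼 n), (π : Measure (𝔼 n)) = ν := ⟨⟨ν, hν.1⟩, rfl⟩
  rw [curveCost_le_curveCost_iff hμ hC hmP hν]
  change J m ≤ J ν
  rcases le_total (J ν) (J δ) with h | h
  · refine hmin ?_
    refine (second_moment_le_lintegral_eW2Sq hμ hC ν).trans ?_
    rw [hDJ]
    exact add_le_add_right (mul_le_mul_right h _) _
  · exact le_trans (hmin (hδ0.le.trans zero_le)) h

end Curve

end Wasserstein

theorem corollary3p2p3 (n : ℕ) (M : Set (EuclideanSpace ℝ (Fin n)))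
    (hM : Bornology.IsBounded M)
    (μ : unitInterval → ProbabilityMeasure (EuclideanSpace ℝ (Fin n)))
    (hμM : ∀ t, (μ t : Measure (EuclideanSpace ℝ (Fin n))) Mᶜ = 0)
    (hμ : Continuous μ) :
    (∀ ν ∈ P2 n,
      (∀ t, eW2Sq (μ t : Measure (EuclideanSpace ℝ (Fin n))) ν < ∞) ∧
      Integrable (fun t : unitInterval ↦
        W2Sq (μ t : Measure (EuclideanSpace ℝ (Fin n))) ν) volume) ∧
    ConvexOn ℝ≥0 (P2 n) (curveCost μ) ∧
    (AssumptionA μ →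
      StrictConvexOn ℝ≥0 (P2 n) (curveCost μ) ∧ ∃! m, IsBarycenter μ m) := by
  obtain ⟨R, hR⟩ := hM.exists_norm_le
  have hC (t : unitInterval) : ∫⁻ x, ‖x‖ₑ ^ 2 ∂(μ t : Measure (EuclideanSpace ℝ (Fin n))) ≤
      ((R.toNNReal ^ 2 : ℝ≥0) : ℝ≥0∞) :=
    lintegral_sq_norm_le_of_concentrated
      (fun x hx ↦ (hR x hx).trans (Real.le_coe_toNNReal R)) (hμM t)
  refine ⟨fun ν hν ↦ ⟨eW2Sq_curve_lt_top hC (ν := ⟨ν, hν.1⟩) hν,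
    integrable_W2Sq_curve hμ hC (ν := ⟨ν, hν.1⟩) hν⟩, convexOn_curveCost hμ hC, fun hA ↦ ?_⟩
  have hstrict := strictConvexOn_curveCost hμ hC hA
  refine ⟨hstrict, ?_⟩
  obtain ⟨m, hm⟩ := exists_isBarycenter hμ hC
  refine ⟨m, hm, fun m' hm' ↦ ?_⟩
  by_contra hne
  have hhalf : (1 / 2 : ℝ≥0) + 1 / 2 = 1 := add_halves 1
  -- The midpoint of two distinct minimizers would cost strictly less than either.
  have hlt := hstrict.2 hm'.1 hm.1 hne (by norm_num) (by norm_num) hhalf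
  have hz := hstrict.1 hm'.1 hm.1 (by norm_num) (by norm_num) hhalf
  refine absurd hlt (not_lt.2 ?_)
  calc (1 / 2 : ℝ≥0) • curveCost μ m' + (1 / 2 : ℝ≥0) • curveCost μ m
      ≤ (1 / 2 : ℝ≥0) • curveCost μ ((1 / 2 : ℝ≥0) • m' + (1 / 2 : ℝ≥0) • m) +
        (1 / 2 : ℝ≥0) • curveCost μ ((1 / 2 : ℝ≥0) • m' + (1 / 2 : ℝ≥0) • m) := by
        gcongr
        · exact hm'.2 _ hz
        · exact hm.2 _ hz
    _ = _ := by rw [← add_smul, hhalf, one_smul]
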